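/- Let $S$ be a finite set of parties and let $r\ge 2$. An entangled hypergraph $H=(S,F)$ is given by a finite set $F$ of hyperedges $E\subseteq S$. It represents the multipartite pure state $$|H\rangle=\bigotimes_{E\in F}|\mathrm{CAT}_E\rangle,\qquad |\mathrm{CAT}_E\rangle=\tfrac1{\sqrt2}\bigl(|0\cdots0\rangle+|1\cdots1\rangle\bigr),$$ where $|\mathrm{CAT}_E\rangle$ is a state of $|E|$ qubits, one held by each member of $E$; thus each party $i$ holds one qubit for every hyperedge containing $i$. $H$ is an $r$-uniform entangled hypertree if - (connectedness) any two distinct vertices $a,b$ are joined by a hyperpath, i.e. a sequence $E_1,\dots,E_j\in F$ ($j\ge1$) with $a\in E_1$, $b\in E_j$ and $E_i\cap E_{i+1}\neq\emptyset$ for $1\le i<j$; - (no cycles) no two vertices $a,b$ are joined by two distinct simple paths, where a simple path from $a$ to $b$ is a sequence $x_0E_1x_1E_2\cdots E_kx_k$ ($k\ge 0$) with $x_0=a$, $x_k=b$, pairwise distinct vertices $x_0,\dots,x_k\in S$, pairwise distinct hyperedges $E_1,\dots,E_k\in F$, and $x_{i-1},x_i\in E_i$ for all $i$; - (uniformity)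 every $E\in F$ has exactly $r$ elements. An LOCC operation is a map on states implemented by a protocol with finitely many rounds; in each round every party performs a quantum measurement with finitely many outcomes on its own finite-dimensional system (this includes local unitaries, adding ancillas and discarding subsystems), which may depend on all outcomes announced before, and announces its outcome to all parties. Two pure states are LOCC-incomparable if neither of them can be transformed into the other exactly and with certainty by an LOCC operation. **Theorem.** Let $H_1=(S,F_1)$ and $H_2=(S,F_2)$ be two distinct $r$-uniform entangled hypertrees on the same finite set $S$ of parties, where $r\ge2$. Then the states $|H_1\rangle$ and $|H_2\rangle$ are LOCC-incomparable. -/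

import Mathlib

universe u

/-! Entangled hypergraphs and hypertrees -/

/-- An entangled hypergraph on the set `S` of parties: a finite set of hyperedges, each of them a
set of parties. A hyperedge `E` stands for one `|E|`-party CAT state shared by the members
of `E`. -/
@[ext]
structure EntangledHypergraph (S : Type u) where
  edges : Finset (Finset S)

namespace EntangledHypergraph

variable {S : Type u} [DecidableEq S]

/-- A hyperpath from `a` to `b`: a nonempty sequence of hyperedges, consecutive ones having a
common vertex, with `a` in the first one and `b` in the last one. -/
def IsHyperpath (H : EntangledHypergraph S) (a b : S) (p : List (Finset S)) : Prop :=
  (∀ E ∈ p, E ∈ H.edges) ∧ p.IsChain (fun E E' => (E ∩ E').Nonempty) ∧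
    ∃ h : p ≠ [], a ∈ p.head h ∧ b ∈ p.getLast h

/-- Every two vertices are joined by a hyperpath. -/
def IsConnected (H : EntangledHypergraph S) : Prop :=
  ∀ a b : S, a ≠ b → ∃ p, H.IsHyperpath a b p

/-- `[(E₁, x₁), …, (Eₖ, xₖ)]` describes the walk `a E₁ x₁ E₂ x₂ … Eₖ xₖ` with `xₖ = b`, in which
each hyperedge contains the two vertices next to it. -/
def IsWalk (H : EntangledHypergraph S) : S → S → List (Finset S × S) → Prop
  | a, b, [] => a = b
  | a, b, (E, x) :: p => E ∈ H.edges ∧ a ∈ E ∧ x ∈ E ∧ H.IsWalk x b p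

/-- A simple path (in the sense of Berge): a walk whose vertices are pairwise distinct and whose
hyperedges are pairwise distinct. -/
def IsSimplePath (H : EntangledHypergraph S) (a b : S) (p : List (Finset S × S)) : Prop :=
  H.IsWalk a b p ∧ (a :: p.map Prod.snd).Nodup ∧ (p.map Prod.fst).Nodup

/-- No cycles: there are no two distinct simple paths between the same two vertices. -/
def IsAcyclic (H : EntangledHypergraph S) : Prop :=
  ∀ a b p q, H.IsSimplePath a b p → H.IsSimplePath a b q → p = q

/-- An entangled hypertree: connected and without cycles. -/
def IsHypertree (H : EntangledHypergraph S) : Prop :=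
  H.IsConnected ∧ H.IsAcyclic

/-- All hyperedges have size `r`. -/
def IsUniform (H : EntangledHypergraph S) (r : ℕ) : Prop :=
  ∀ E ∈ H.edges, E.card = r

end EntangledHypergraph

/-! Local operations and classical communication -/

/-- Finite-dimensional quantum systems held by the parties in `S`: the system of party `i` is the
Hilbert space with orthonormal basis indexed by the finite type `basis i`. -/
structure PartySystems (S : Type u) where
  basis : S → Type u
  [fintypeBasis : ∀ i, Fintype (basis i)]
  [decEqBasis : ∀ i, DecidableEq (basis i)]

attribute [instance] PartySystems.fintypeBasis PartySystems.decEqBasis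

namespace PartySystems

variable {S : Type u}

/-- Index set of the product basis of the tensor product of all the systems. -/
abbrev Config (X : PartySystems S) : Type u := ∀ i, X.basis i

/-- Operators on the joint system, in particular its density matrices. -/
abbrev Op (X : PartySystems S) : Type u := Matrix X.Config X.Config ℂ

/-- The tensor product `⨂ i, K i` of operators of the single parties. -/
def tensor [Fintype S] {X Y : PartySystems S}
    (K : ∀ i, Matrix (Y.basis i) (X.basis i) ℂ) : Matrix Y.Config X.Config ℂ :=
  Matrix.of fun y x => ∏ i, K i (y i) (x i)

end PartySystems

/-- A general quantum measurement taking a system with basis `A` to a system with basis `B`: one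
Kraus operator for each of the finitely many outcomes. It covers unitaries and isometries
(adjoining an ancilla), projective measurements, and the discarding of a subsystem (measuring it,
the outcome being ignored afterwards). -/
structure LocalMeasurement (A B : Type u) [Fintype A] [DecidableEq A] [Fintype B] where
  outcomes : ℕ
  kraus : Fin outcomes → Matrix B A ℂ
  complete : ∑ o, (kraus o).conjTranspose * kraus o = 1

/-- The LOCC operations, i.e. the maps on density matrices implemented by protocols with finitely
many rounds. In a round every party measures its own system and broadcasts the outcome; the rest
of the protocol depends on all the outcomes announced so far. The resulting state is averaged over
the outcomes. -/
inductive IsLOCC {S : Type u} [Fintype S] [DecidableEq S] :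
    (X Z : PartySystems S) → (X.Op → Z.Op) → Prop
  | done (X : PartySystems S) : IsLOCC X X (fun ρ => ρ)
  | round (X Y Z : PartySystems S)
      (M : ∀ i, LocalMeasurement (X.basis i) (Y.basis i))
      (Φ : (∀ i, Fin (M i).outcomes) → Y.Op → Z.Op)
      (hΦ : ∀ o, IsLOCC Y Z (Φ o)) :
      IsLOCC X Z (fun ρ => ∑ o, Φ o
        (PartySystems.tensor (fun i => (M i).kraus (o i)) * ρ *
          (PartySystems.tensor (fun i => (M i).kraus (o i))).conjTranspose))

/-- The density matrix `|ψ⟩⟨ψ|` of a pure state `ψ`. -/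
def pureDensity {S : Type u} {X : PartySystems S} (ψ : X.Config → ℂ) : X.Op :=
  Matrix.vecMulVec ψ (star ψ)

/-- Some LOCC operation takes the pure state `ψ` to the pure state `φ` (with certainty). -/
def LOCCConvertible {S : Type u} [Fintype S] [DecidableEq S] {X Y : PartySystems S}
    (ψ : X.Config → ℂ) (φ : Y.Config → ℂ) : Prop :=
  ∃ Φ : X.Op → Y.Op, IsLOCC X Y Φ ∧ Φ (pureDensity ψ) = pureDensity φ

/-- Neither of the two states can be obtained from the other one by LOCC. -/
def LOCCIncomparable {S : Type u} [Fintype S] [DecidableEq S] {X Y : PartySystems S}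
    (ψ : X.Config → ℂ) (φ : Y.Config → ℂ) : Prop :=
  ¬ LOCCConvertible ψ φ ∧ ¬ LOCCConvertible φ ψ

/-! The state of an entangled hypergraph -/

/-- The CAT state `(|0…0⟩ + |1…1⟩) / √2` of qubits indexed by `ι`, by its amplitudes in the
computational basis. -/
noncomputable def catState (ι : Type u) [Fintype ι] (q : ι → Fin 2) : ℂ :=
  ((if ∀ i, q i = 0 then 1 else 0) + (if ∀ i, q i = 1 then 1 else 0)) / (Real.sqrt 2 : ℂ)

namespace EntangledHypergraph

variable {S : Type u} [Fintype S] [DecidableEq S]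

/-- Party `i` holds one qubit for each hyperedge which contains `i`. -/
def systems (H : EntangledHypergraph S) : PartySystems S where
  basis i := {E : Finset S // E ∈ H.edges ∧ i ∈ E} → Fin 2

/-- The multipartite state of `H`: the tensor product, over the hyperedges `E`, of the CAT states
of the qubits which the members of `E` hold for `E`. -/
noncomputable def state (H : EntangledHypergraph S) : H.systems.Config → ℂ :=
  fun x => ∏ E : {E // E ∈ H.edges},
    catState {i // i ∈ E.1} (fun i => x i.1 ⟨E.1, E.2, i.2⟩)

end EntangledHypergraph

/-!
LOCC convertibility is obstructed by the Schmidt ranks across bipartite cuts alone.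

Every LOCC operation is a sum of conjugations by product operators (`IsLOCC.exists_kraus`). Since a
pure state is extremal, each branch of a protocol with a pure outcome yields a multiple of this
outcome, so some product operator maps the initial vector to a nonzero multiple of the final one
(`LOCCConvertible.exists_tensor_mulVec`). Product operators do not increase the Schmidt rank
across a cut `A | Aᶜ` (`rank_cutMatrix_tensor_mulVec_le`), and for the state of a hypergraph this
rank is `2 ^ k`, where `k` is the number of hyperedges meeting both sides. Hence a conversion of
`H₁` into `H₂` forces every cut to separate at least as many hyperedges of `H₁` as of `H₂`
(`EntangledHypergraph.card_cutEdges_le_of_LOCCConvertible`).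

The rest is combinatorics (`EntangledHypergraph.eq_of_card_cutEdges_le`). The incidence graph of a
hypertree is a tree, so `r`-uniform hypertrees on the same vertices have equally many hyperedges.
The cut around one vertex counts its degree; the degrees of both hypertrees have the same sum,
so they agree. The cut around two vertices then counts, by inclusion-exclusion, the hyperedges
containing both, so two vertices with a common hyperedge in `H₁` have one in `H₂`. As there are no
cycles, pairwise adjacent vertices of `H₂` lie in a single hyperedge; so each hyperedge of `H₁`
is one of `H₂`, and `H₁ = H₂`.
-/

/-! ### Product operators and Kraus decompositions -/

namespace PartySystems

variable {S : Type u} [Fintype S]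

theorem tensor_one [DecidableEq S] (X : PartySystems S) :
    tensor (fun i => (1 : Matrix (X.basis i) (X.basis i) ℂ)) = 1 := by
  ext y x
  simp only [tensor, Matrix.of_apply, Matrix.one_apply, Finset.prod_ite_zero, Finset.prod_const_one,
    Finset.mem_univ, forall_true_left, funext_iff]

theorem tensor_mul [DecidableEq S] {X Y Z : PartySystems S}
    (L : ∀ i, Matrix (Z.basis i) (Y.basis i) ℂ) (K : ∀ i, Matrix (Y.basis i) (X.basis i) ℂ) :
    tensor L * tensor K = tensor (fun i => L i * K i) := by
  ext z x
  simp only [tensor, Matrix.mul_apply, Matrix.of_apply, Finset.prod_univ_sum,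
    Fintype.piFinset_univ, Finset.prod_mul_distrib]

end PartySystems

open PartySystems

/-- Every LOCC operation is separable: it has a Kraus decomposition into product operators. -/
theorem IsLOCC.exists_kraus {S : Type u} [Fintype S] [DecidableEq S] {X Z : PartySystems S}
    {Φ : X.Op → Z.Op} (h : IsLOCC X Z Φ) :
    ∃ (J : Type u) (_ : Fintype J) (K : J → ∀ i, Matrix (Z.basis i) (X.basis i) ℂ),
      ∀ ρ, Φ ρ = ∑ j, tensor (K j) * ρ * (tensor (K j)).conjTranspose := by
  induction h with
  | done X =>
    exact ⟨PUnit, inferInstance, fun _ _ => 1, fun ρ => by simp [tensor_one]⟩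
  | round X Y Z M Φ hΦ ih =>
    choose J hJ K hK using ih
    refine ⟨Σ o, J o, inferInstance, fun j i => K j.1 j.2 i * (M i).kraus (j.1 i), fun ρ => ?_⟩
    rw [Fintype.sum_sigma]
    refine Finset.sum_congr rfl fun o _ => ?_
    rw [hK]
    refine Finset.sum_congr rfl fun j _ => ?_
    simp only [← tensor_mul, Matrix.conjTranspose_mul, Matrix.mul_assoc]

/-- A pure density matrix is extremal: if it is a sum of pure (unnormalized) density matrices, some
summand is a nonzero multiple of it. -/
theorem exists_smul_eq_of_sum_vecMulVec_eq {n J : Type*} [Finite n] [Fintype J] (v : J → n → ℂ)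
    (φ : n → ℂ) (hφ : φ ≠ 0)
    (h : ∑ j, Matrix.vecMulVec (v j) (star (v j)) = Matrix.vecMulVec φ (star φ)) :
    ∃ j, ∃ c : ℂ, c ≠ 0 ∧ v j = c • φ := by
  have hent (x y : n) : ∑ j, v j x * star (v j y) = φ x * star (φ y) := by
    simpa [Matrix.sum_apply, Matrix.vecMulVec_apply] using congrFun (congrFun h x) y
  obtain ⟨y, hy⟩ : ∃ y, φ y ≠ 0 := by
    by_contra! hc
    exact hφ (funext hc)
  -- The functional `w ↦ φ y * w x - φ x * w y` kills `φ`, hence every `v j`.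
  have hprop (j : J) (x : n) : φ y * v j x = φ x * v j y := by
    have hs : ∑ j, (φ y * v j x - φ x * v j y) * star (φ y * v j x - φ x * v j y) = 0 := by
      calc _ = φ y * star (φ y) * ∑ j, v j x * star (v j x)
            - φ y * star (φ x) * ∑ j, v j x * star (v j y)
            - φ x * star (φ y) * ∑ j, v j y * star (v j x)
            + φ x * star (φ x) * ∑ j, v j y * star (v j y) := by
              simp only [Finset.mul_sum, ← Finset.sum_sub_distrib, ← Finset.sum_add_distrib]
              refine Finset.sum_congr rfl fun j _ => ?_
              simp only [star_sub, star_mul']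
              ring
        _ = 0 := by
              simp only [hent]
              ring
    have hs' : ∑ j, ‖φ y * v j x - φ x * v j y‖ ^ 2 = 0 := by
      have : ((∑ j, ‖φ y * v j x - φ x * v j y‖ ^ 2 : ℝ) : ℂ) = 0 := by
        rw [← hs]
        push_cast
        exact Finset.sum_congr rfl fun j _ => (Complex.mul_conj' _).symm
      exact_mod_cast this
    have := (Finset.sum_eq_zero_iff_of_nonneg fun _ _ => by positivity).1 hs' j (Finset.mem_univ j)
    exact sub_eq_zero.1 (norm_eq_zero.1 (pow_eq_zero_iff two_ne_zero |>.1 this))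
  obtain ⟨j, hj⟩ : ∃ j, v j y ≠ 0 := by
    by_contra! hc
    have := hent y y
    simp [hc, hy] at this
  refine ⟨j, v j y / φ y, div_ne_zero hj hy, funext fun x => ?_⟩
  rw [Pi.smul_apply, smul_eq_mul, div_mul_eq_mul_div, eq_div_iff hy]
  linear_combination hprop j x

/-- LOCC conversion with certainty implies conversion by a single product operator. -/
theorem LOCCConvertible.exists_tensor_mulVec {S : Type u} [Fintype S] [DecidableEq S]
    {X Y : PartySystems S} {ψ : X.Config → ℂ} {φ : Y.Config → ℂ} (h : LOCCConvertible ψ φ)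
    (hφ : φ ≠ 0) :
    ∃ (K : ∀ i, Matrix (Y.basis i) (X.basis i) ℂ) (c : ℂ), c ≠ 0 ∧
      (tensor K).mulVec ψ = c • φ := by
  obtain ⟨Φ, hΦ, hψ⟩ := h
  obtain ⟨J, _, K, hK⟩ := hΦ.exists_kraus
  rw [hK] at hψ
  obtain ⟨j, c, hc, hj⟩ := exists_smul_eq_of_sum_vecMulVec_eq
    (fun j => (tensor (K j)).mulVec ψ) φ hφ (by
      refine Eq.trans ?_ hψ
      refine Finset.sum_congr rfl fun j _ => ?_
      rw [pureDensity, Matrix.mul_vecMulVec, Matrix.vecMulVec_mul, Matrix.star_mulVec])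
  exact ⟨K j, c, hc, hj⟩

/-! ### The Schmidt rank across a cut -/

section Cut

variable {S : Type u} [Fintype S] [DecidableEq S]

/-- The amplitudes of `ψ` as a matrix whose row describes the parties in `A` and whose column
describes the others. Rows and columns are indexed by configurations of all the parties, of which
only the relevant coordinates are used; repeated rows and columns do not change the rank, which
is the Schmidt rank of `ψ` across the cut between `A` and its complement. -/
def cutMatrix {X : PartySystems S} (A : Finset S) (ψ : X.Config → ℂ) :
    Matrix X.Config X.Config ℂ :=
  Matrix.of fun x y => ψ (A.piecewise x y)

/-- Every configuration arises from equally many pairs of configurations by cutting and pasting. -/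
theorem sum_sum_piecewise {X : PartySystems S} (A : Finset S) (f : X.Config → ℂ) :
    ∑ x, ∑ y, f (A.piecewise x y) = Fintype.card X.Config * ∑ z, f z := by
  let e : X.Config × X.Config → X.Config × X.Config :=
    fun p => (A.piecewise p.1 p.2, A.piecewise p.2 p.1)
  have he : Function.Involutive e := fun p => by
    ext i <;> by_cases hi : i ∈ A <;> simp [e, hi]
  rw [← Fintype.sum_prod_type', he.bijective.sum_comp (fun p => f p.1)]
  simp [Fintype.sum_prod_type, Finset.mul_sum]

/-- A product operator does not increase the Schmidt rank: it multiplies the amplitude matrix on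
the left by the factors of the parties in `A` and on the right by those of the other parties. -/
theorem rank_cutMatrix_tensor_mulVec_le {X Y : PartySystems S} [Nonempty X.Config] (A : Finset S)
    (K : ∀ i, Matrix (Y.basis i) (X.basis i) ℂ) (ψ : X.Config → ℂ) :
    (cutMatrix A ((tensor K).mulVec ψ)).rank ≤ (cutMatrix A ψ).rank := by
  -- Rows and columns are indexed by all the parties, so the idle factors are all-ones matrices;
  -- they multiply the result by the number of configurations, as in `sum_sum_piecewise`.
  let L : Matrix Y.Config X.Config ℂ := tensor (A.piecewise K fun _ => Matrix.of fun _ _ => 1)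
  let R : Matrix Y.Config X.Config ℂ := tensor (A.piecewise (fun _ => Matrix.of fun _ _ => 1) K)
  have hmul (x' y' : Y.Config) (x y : X.Config) :
      L x' x * R y' y = tensor K (A.piecewise x' y') (A.piecewise x y) := by
    simp only [L, R, tensor, Matrix.of_apply, ← Finset.prod_mul_distrib]
    refine Finset.prod_congr rfl fun i _ => ?_
    by_cases hi : i ∈ A <;> simp [hi]
  have hN : (Fintype.card X.Config : ℂ) ≠ 0 := Nat.cast_ne_zero.2 Fintype.card_ne_zero
  have key : (Fintype.card X.Config : ℂ) • cutMatrix A ((tensor K).mulVec ψ) =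
      L * cutMatrix A ψ * R.transpose := by
    ext x' y'
    have := sum_sum_piecewise A fun z => tensor K (A.piecewise x' y') z * ψ z
    simp only [Matrix.smul_apply, cutMatrix, Matrix.of_apply, Matrix.mulVec, dotProduct,
      smul_eq_mul, ← this, Matrix.mul_apply, Matrix.transpose_apply, ← hmul, Finset.sum_mul]
    rw [Finset.sum_comm]
    refine Finset.sum_congr rfl fun y _ => Finset.sum_congr rfl fun x _ => ?_
    ring
  rw [← Matrix.rank_smul_of_mem_nonZeroDivisors _ (mem_nonZeroDivisors_of_ne_zero hN), key]
  exact (Matrix.rank_mul_le_left _ _).trans (Matrix.rank_mul_le_right _ _)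

end Cut

/-! ### The Schmidt rank of the state of a hypergraph -/

namespace EntangledHypergraph

section State

variable {S : Type u} [DecidableEq S]

/-- The hyperedges having members both inside and outside of `A`. -/
def cutEdges (H : EntangledHypergraph S) (A : Finset S) : Finset (Finset S) :=
  {E ∈ H.edges | (∃ i ∈ E, i ∈ A) ∧ ∃ i ∈ E, i ∉ A}

/-- The assignments of a bit to each hyperedge that give `0` to the hyperedges which the cut does
not separate. They label the terms of a Schmidt decomposition of the state of `H`. -/
def cutLabels (H : EntangledHypergraph S) (A : Finset S) :
    Finset ({E // E ∈ H.edges} → Fin 2) :=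
  Fintype.piFinset fun E => if E.1 ∈ H.cutEdges A then Finset.univ else {0}

theorem card_cutLabels (H : EntangledHypergraph S) (A : Finset S) :
    (H.cutLabels A).card = 2 ^ (H.cutEdges A).card := by
  have h (E : {E // E ∈ H.edges}) :
      (if E.1 ∈ H.cutEdges A then (Finset.univ : Finset (Fin 2)) else {0}).card =
        if E.1 ∈ H.cutEdges A then 2 else 1 := by
    split_ifs <;> simp
  rw [cutLabels, Fintype.card_piFinset, Finset.prod_congr rfl fun E _ => h E,
    Finset.prod_coe_sort H.edges fun E => if E ∈ H.cutEdges A then 2 else 1,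
    Finset.prod_ite, Finset.prod_const, Finset.prod_const_one, mul_one]
  congr 2
  ext E
  simp +contextual [cutEdges]

variable [Fintype S]

instance (H : EntangledHypergraph S) (i : S) : Inhabited (H.systems.basis i) := ⟨fun _ => 0⟩

/-- The configuration in which all qubits of the hyperedge `E` have the value `s E`. -/
def constConfig (H : EntangledHypergraph S) (s : {E // E ∈ H.edges} → Fin 2) :
    H.systems.Config :=
  fun _ E => s ⟨E.1, E.2.1⟩

theorem catState_const_ne_zero {ι : Type u} [Fintype ι] (b : Fin 2) :
    catState ι (fun _ => b) ≠ 0 := by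
  have h2 : (Real.sqrt 2 : ℂ) ≠ 0 := by simp
  fin_cases b <;> by_cases h : IsEmpty ι <;>
    simp_all [catState, one_add_one_eq_two]

/-- The Schmidt rank of the state of a hypergraph is at most `2 ^ k`, where `k` is the number of
CAT states that the cut separates: a separated CAT state is the sum of two product vectors, and
one which is not separated is a vector of one side. -/
theorem rank_cutMatrix_state_le (H : EntangledHypergraph S) (A : Finset S) :
    (cutMatrix A H.state).rank ≤ 2 ^ (H.cutEdges A).card := by
  let q (x : H.systems.Config) (E : {E // E ∈ H.edges}) : {i // i ∈ E.1} → Fin 2 :=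
    fun i => x i.1 ⟨E.1, E.2, i.2⟩
  -- The factors of the CAT state of `E` on the two sides, for the bit `b`. A CAT state which is not
  -- separated goes as a whole to the side of `A` if it has a member there, else to the other side.
  let g (x : H.systems.Config) (E : {E // E ∈ H.edges}) (b : Fin 2) : ℂ :=
    if E.1 ∈ H.cutEdges A then (if ∀ i, i.1 ∈ A → q x E i = b then 1 else 0) / (Real.sqrt 2 : ℂ)
    else if ∃ i ∈ E.1, i ∈ A then catState _ (q x E) else 1
  let h (y : H.systems.Config) (E : {E // E ∈ H.edges}) (b : Fin 2) : ℂ :=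
    if E.1 ∈ H.cutEdges A then if ∀ i, i.1 ∉ A → q y E i = b then 1 else 0
    else if ∃ i ∈ E.1, i ∈ A then 1 else catState _ (q y E)
  have hcat (x y : H.systems.Config) (E : {E // E ∈ H.edges}) :
      catState _ (q (A.piecewise x y) E) =
        ∑ b ∈ (if E.1 ∈ H.cutEdges A then Finset.univ else {0}), g x E b * h y E b := by
    by_cases hE : E.1 ∈ H.cutEdges A
    · have hq (b : Fin 2) : (∀ i, q (A.piecewise x y) E i = b) ↔
          (∀ i, i.1 ∈ A → q x E i = b) ∧ ∀ i, i.1 ∉ A → q y E i = b := by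
        rw [← forall_and]
        refine forall_congr' fun i => ?_
        by_cases hi : i.1 ∈ A <;> simp [q, hi]
      simp only [hE, if_true, Fin.sum_univ_two, g, h, catState, hq, ite_and]
      split_ifs <;> ring
    · simp only [hE, if_false, Finset.sum_singleton, g, h]
      by_cases hA : ∃ i ∈ E.1, i ∈ A
      · have hsub : ∀ i ∈ E.1, i ∈ A := by
          intro i hi
          by_contra hiA
          exact hE (Finset.mem_filter.2 ⟨E.2, hA, i, hi, hiA⟩)
        simp only [hA, if_true, mul_one]
        congr 1
        ext i : 1
        simp [q, hsub i.1 i.2]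
      · simp only [hA, if_false, one_mul]
        congr 1
        ext i : 1
        have : i.1 ∉ A := fun hi => hA ⟨i.1, i.2, hi⟩
        simp [q, this]
  let G : Matrix H.systems.Config (H.cutLabels A) ℂ :=
    Matrix.of fun x s => ∏ E, g x E (s.1 E)
  let R : Matrix (H.cutLabels A) H.systems.Config ℂ :=
    Matrix.of fun s y => ∏ E, h y E (s.1 E)
  have hGR : cutMatrix A H.state = G * R := by
    ext x y
    simp only [Matrix.mul_apply, G, R, Matrix.of_apply, ← Finset.prod_mul_distrib]
    rw [Finset.sum_coe_sort (H.cutLabels A) fun s => ∏ E, g x E (s E) * h y E (s E)]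
    exact (Finset.prod_congr rfl fun E _ => hcat x y E).trans (Finset.prod_univ_sum _ _)
  calc (cutMatrix A H.state).rank ≤ G.rank := hGR ▸ Matrix.rank_mul_le_left G R
    _ ≤ Fintype.card (H.cutLabels A) := G.rank_le_card_width
    _ = _ := by rw [Fintype.card_coe, card_cutLabels]

theorem state_piecewise_constConfig_of_ne (H : EntangledHypergraph S) {A : Finset S}
    {s t : {E // E ∈ H.edges} → Fin 2} (hs : s ∈ H.cutLabels A) (ht : t ∈ H.cutLabels A)
    (hst : s ≠ t) : H.state (A.piecewise (H.constConfig s) (H.constConfig t)) = 0 := by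
  obtain ⟨E, hE⟩ := Function.ne_iff.1 hst
  have hs := Fintype.mem_piFinset.1 hs E
  have ht := Fintype.mem_piFinset.1 ht E
  have hcut : E.1 ∈ H.cutEdges A := by
    by_contra hc
    rw [if_neg hc, Finset.mem_singleton] at hs ht
    exact hE (hs.trans ht.symm)
  obtain ⟨-, ⟨i, hiE, hiA⟩, j, hjE, hjA⟩ := Finset.mem_filter.1 hcut
  refine Finset.prod_eq_zero (Finset.mem_univ E) ?_
  have hne (b : Fin 2) : ¬ ∀ k : {i // i ∈ E.1},
      A.piecewise (H.constConfig s) (H.constConfig t) k.1 ⟨E.1, E.2, k.2⟩ = b := by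
    intro hk
    have h1 := hk ⟨i, hiE⟩
    have h2 := hk ⟨j, hjE⟩
    rw [Finset.piecewise_eq_of_mem _ _ _ hiA] at h1
    rw [Finset.piecewise_eq_of_notMem _ _ _ hjA] at h2
    exact hE (h1.trans h2.symm)
  simp only [catState, hne, if_false, add_zero, zero_div]

theorem state_constConfig_ne_zero (H : EntangledHypergraph S)
    (s : {E // E ∈ H.edges} → Fin 2) : H.state (H.constConfig s) ≠ 0 :=
  Finset.prod_ne_zero_iff.2 fun E _ => catState_const_ne_zero (s E)

theorem state_ne_zero (H : EntangledHypergraph S) : H.state ≠ 0 := fun h =>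
  H.state_constConfig_ne_zero (fun _ => 0) (congrFun h _)

/-- The bound of `rank_cutMatrix_state_le` is attained: the labels index a diagonal submatrix with
nonzero diagonal entries. -/
theorem le_rank_cutMatrix_state (H : EntangledHypergraph S) (A : Finset S) :
    2 ^ (H.cutEdges A).card ≤ (cutMatrix A H.state).rank := by
  let f (s : H.cutLabels A) : H.systems.Config := H.constConfig s.1
  have hdiag : (cutMatrix A H.state).submatrix f f =
      Matrix.diagonal fun s => H.state (f s) := by
    ext s t
    rw [Matrix.submatrix_apply, cutMatrix, Matrix.of_apply, Matrix.diagonal_apply]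
    split_ifs with hst
    · rw [hst, Finset.piecewise_same]
    · exact H.state_piecewise_constConfig_of_ne s.2 t.2 fun h => hst (Subtype.ext h)
  have hne (s : H.cutLabels A) : H.state (f s) ≠ 0 := H.state_constConfig_ne_zero s.1
  calc 2 ^ (H.cutEdges A).card = (Matrix.diagonal fun s => H.state (f s)).rank := by
        rw [Matrix.rank_diagonal, Fintype.card_congr (Equiv.subtypeUnivEquiv hne),
          Fintype.card_coe, card_cutLabels]
    _ = ((cutMatrix A H.state).submatrix f f).rank := by rw [hdiag]
    _ ≤ _ := Matrix.rank_submatrix_le _ f f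

/-- An LOCC conversion cannot increase the number of CAT states separated by a cut. -/
theorem card_cutEdges_le_of_LOCCConvertible {H₁ H₂ : EntangledHypergraph S}
    (h : LOCCConvertible H₁.state H₂.state) (A : Finset S) :
    (H₂.cutEdges A).card ≤ (H₁.cutEdges A).card := by
  obtain ⟨K, c, hc, hK⟩ := h.exists_tensor_mulVec H₂.state_ne_zero
  refine (Nat.pow_le_pow_iff_right one_lt_two).1 ?_
  calc 2 ^ (H₂.cutEdges A).card ≤ (cutMatrix A H₂.state).rank := H₂.le_rank_cutMatrix_state A
    _ = (c • cutMatrix A H₂.state).rank :=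
        (Matrix.rank_smul_of_mem_nonZeroDivisors _ (mem_nonZeroDivisors_of_ne_zero hc)).symm
    _ = (cutMatrix A ((tensor K).mulVec H₁.state)).rank := by rw [hK]; rfl
    _ ≤ (cutMatrix A H₁.state).rank := rank_cutMatrix_tensor_mulVec_le A K _
    _ ≤ _ := H₁.rank_cutMatrix_state_le A

end State

/-! ### Simple paths -/

section Hypertree

variable {S : Type u} {H : EntangledHypergraph S}

theorem IsWalk.of_append {a b : S} {p q : List (Finset S × S)} {F : Finset S} {x : S}
    (h : H.IsWalk a b (p ++ (F, x) :: q)) : F ∈ H.edges ∧ x ∈ F ∧ H.IsWalk x b q := by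
  induction p generalizing a with
  | nil => exact ⟨h.1, h.2.2.1, h.2.2.2⟩
  | cons e p ih => exact ih h.2.2.2

theorem IsSimplePath.of_append {a b : S} {p q : List (Finset S × S)} {F : Finset S} {x : S}
    (h : H.IsSimplePath a b (p ++ (F, x) :: q)) : H.IsSimplePath x b q := by
  obtain ⟨hw, hv, he⟩ := h
  rw [List.nodup_cons, List.map_append, List.nodup_append] at hv
  rw [List.map_append, List.nodup_append] at he
  exact ⟨hw.of_append.2.2, hv.2.2.1, (List.nodup_cons.1 he.2.1).2⟩

/-- A simple path can be extended at its start by a vertex sharing a hyperedge with its first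
vertex, after removing the detour which this may create. -/
theorem IsSimplePath.exists_extend [DecidableEq S] {a b c : S} {p : List (Finset S × S)}
    {F : Finset S}
    (h : H.IsSimplePath b c p) (hF : F ∈ H.edges) (ha : a ∈ F) (hb : b ∈ F) :
    ∃ q, H.IsSimplePath a c q ∧ ∀ E ∈ q.map Prod.fst, E = F ∨ E ∈ p.map Prod.fst := by
  by_cases hab : a = b
  · exact ⟨p, hab ▸ h, fun E hE => .inr hE⟩
  -- If `p` returns to `a` or uses `F`, only the part of it from there on is kept.
  by_cases hap : a ∈ p.map Prod.snd
  · obtain ⟨⟨D, a'⟩, hD, rfl⟩ := List.mem_map.1 hap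
    obtain ⟨p₁, q, rfl⟩ := List.append_of_mem hD
    exact ⟨q, h.of_append, fun E hE => .inr (by simp [List.mem_map.1 hE])⟩
  by_cases hFp : F ∈ p.map Prod.fst
  · obtain ⟨⟨F', x⟩, hD, rfl⟩ := List.mem_map.1 hFp
    obtain ⟨p₁, q, rfl⟩ := List.append_of_mem hD
    obtain ⟨hw, hv, he⟩ := h
    refine ⟨(F', x) :: q, ⟨⟨hF, ha, hw.of_append.2⟩, ?_, ?_⟩, fun E hE => .inr ?_⟩
    · rw [List.nodup_cons, List.map_append, List.nodup_append] at hv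
      rw [List.map_append, List.mem_append, not_or] at hap
      exact List.nodup_cons.2 ⟨hap.2, hv.2.2.1⟩
    · rw [List.map_append, List.nodup_append] at he
      exact he.2.1
    · rw [List.map_append]
      exact List.mem_append_right _ hE
  · refine ⟨(F, b) :: p, ⟨⟨hF, ha, hb, h.1⟩, ?_, List.nodup_cons.2 ⟨hFp, h.2.2⟩⟩, ?_⟩
    · refine List.nodup_cons.2 ⟨?_, h.2.1⟩
      simp only [List.map_cons, List.mem_cons, not_or]
      exact ⟨hab, hap⟩
    · simp

theorem isSimplePath_singleton {a b : S} {E : Finset S} (hE : E ∈ H.edges) (ha : a ∈ E)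
    (hb : b ∈ E) (hab : a ≠ b) : H.IsSimplePath a b [(E, b)] :=
  ⟨⟨hE, ha, hb, rfl⟩, by simpa, by simp⟩

/-! ### Counting the hyperedges of a hypertree -/

/-- The bipartite graph whose vertices are the parties and the hyperedges, a party being adjacent
to the hyperedges that contain it. -/
def incidenceGraph (H : EntangledHypergraph S) : SimpleGraph (S ⊕ {E // E ∈ H.edges}) where
  Adj
    | .inl x, .inr E => x ∈ E.1
    | .inr E, .inl x => x ∈ E.1
    | _, _ => False
  symm := ⟨by rintro (x | E) (y | F) h <;> exact h⟩
  loopless := ⟨by rintro (x | E) h <;> exact h⟩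

theorem IsHyperpath.reachable [DecidableEq S] {a b : S} {p : List (Finset S)}
    (h : H.IsHyperpath a b p) :
    H.incidenceGraph.Reachable (.inl a) (.inl b) := by
  have step {E : Finset S} (hE : E ∈ H.edges) {x y : S} (hx : x ∈ E) (hy : y ∈ E) :
      H.incidenceGraph.Reachable (.inl x) (.inl y) := by
    have h1 : H.incidenceGraph.Adj (.inl x) (.inr ⟨E, hE⟩) := hx
    have h2 : H.incidenceGraph.Adj (.inr ⟨E, hE⟩) (.inl y) := hy
    exact h1.reachable.trans h2.reachable
  obtain ⟨hp, hc, hne, ha, hb⟩ := h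
  induction p generalizing a with
  | nil => exact absurd rfl hne
  | cons E p ih =>
    have hE := hp E (by simp)
    cases p with
    | nil => exact step hE ha hb
    | cons F p =>
      obtain ⟨⟨c, hcEF⟩, hc'⟩ := List.isChain_cons_cons.1 hc
      rw [Finset.mem_inter] at hcEF
      exact (step hE ha hcEF.1).trans
        (ih (fun D hD => hp D (List.mem_cons_of_mem _ hD)) hc' (by simp) hcEF.2 (by simpa using hb))

theorem IsConnected.connected_incidenceGraph [DecidableEq S] [Nonempty S] (h : H.IsConnected)
    (hne : ∀ E ∈ H.edges, E.Nonempty) : H.incidenceGraph.Connected := by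
  obtain ⟨a⟩ := ‹Nonempty S›
  have hS (x : S) : H.incidenceGraph.Reachable (.inl a) (.inl x) := by
    by_cases hx : a = x
    · rw [hx]
    · obtain ⟨p, hp⟩ := h a x hx
      exact hp.reachable
  refine (SimpleGraph.connected_iff_exists_forall_reachable _).2 ⟨.inl a, ?_⟩
  rintro (x | E)
  · exact hS x
  · obtain ⟨x, hx⟩ := hne E.1 E.2
    have hadj : H.incidenceGraph.Adj (.inl x) (.inr E) := hx
    exact (hS x).trans hadj.reachable

/-- If removing the incidence of `x` and `E` did not separate `x` from `E`, a simple path avoiding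
`E` would lead from another vertex of `E` to `x`, besides the path through `E`. -/
theorem IsAcyclic.isAcyclic_incidenceGraph [DecidableEq S] (h : H.IsAcyclic) :
    H.incidenceGraph.IsAcyclic := by
  have bridge (x : S) (E : {E // E ∈ H.edges}) (hx : x ∈ E.1) :
      H.incidenceGraph.IsBridge s(.inl x, .inr E) := by
    rw [SimpleGraph.isBridge_iff]
    intro hr
    -- Follow the walk from `x` until it first reaches `E`, or as far as it avoids `E`. The step
    -- into `E` comes from a vertex `y ≠ x`, since the edge between `x` and `E` is deleted.
    have key (w) (hw : (H.incidenceGraph.deleteEdges {s(.inl x, .inr E)}).Reachable (.inl x) w) :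
        (∃ y ∈ E.1, y ≠ x ∧ ∃ p, H.IsSimplePath y x p ∧ E.1 ∉ p.map Prod.fst) ∨
        Sum.elim (fun y => ∃ p, H.IsSimplePath y x p ∧ E.1 ∉ p.map Prod.fst)
          (fun F => F ≠ E ∧ ∃ y ∈ F.1, ∃ p, H.IsSimplePath y x p ∧ E.1 ∉ p.map Prod.fst) w := by
      rw [SimpleGraph.reachable_iff_reflTransGen] at hw
      induction hw with
      | refl => exact .inr ⟨[], ⟨rfl, by simp, by simp⟩, by simp⟩
      | @tail v w _ hvw ih =>
        rcases ih with ih | ih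
        · exact .inl ih
        rw [SimpleGraph.deleteEdges_adj, Set.mem_singleton_iff] at hvw
        obtain ⟨hadj, hdel⟩ := hvw
        rcases v with y | F <;> rcases w with z | D
        · exact hadj.elim
        · by_cases hD : D = E
          · subst hD
            exact .inl ⟨y, hadj, by rintro rfl; exact hdel rfl, ih⟩
          · exact .inr ⟨hD, y, hadj, ih⟩
        · obtain ⟨hFE, y, hy, p, hp, hEp⟩ := ih
          obtain ⟨q, hq, hqp⟩ := hp.exists_extend F.2 hadj hy
          refine .inr ⟨q, hq, fun hE => ?_⟩
          rcases hqp _ hE with hE | hE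
          · exact hFE (Subtype.ext hE.symm)
          · exact hEp hE
        · exact hadj.elim
    rcases key _ hr with ⟨y, hy, hyx, p, hp, hEp⟩ | hEE
    · refine hEp ?_
      rw [h _ _ _ _ hp (isSimplePath_singleton E.2 hy hx hyx)]
      simp
    · exact hEE.1 rfl
  refine SimpleGraph.isAcyclic_iff_forall_adj_isBridge.2 ?_
  rintro (x | E) (y | F) hadj
  · exact hadj.elim
  · exact bridge x F hadj
  · rw [Sym2.eq_swap]
    exact bridge y E hadj
  · exact hadj.elim

/-- The incidence graph is a tree with `|S| + |F|` vertices and `r |F|` edges. -/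
theorem IsHypertree.card_eq [Fintype S] [DecidableEq S] [Nonempty S] {r : ℕ}
    (h : H.IsHypertree) (hU : H.IsUniform r) (hr : r ≠ 0) :
    H.edges.card * r + 1 = Fintype.card S + H.edges.card := by
  classical
  have htree : H.incidenceGraph.IsTree :=
    ⟨h.1.connected_incidenceGraph fun E hE => Finset.card_ne_zero.1 (hU E hE ▸ hr),
      h.2.isAcyclic_incidenceGraph⟩
  have hbip : H.incidenceGraph.IsBipartiteWith
      (Finset.univ.map Function.Embedding.inr : Finset (S ⊕ {E // E ∈ H.edges}))
      (Finset.univ.map Function.Embedding.inl : Finset (S ⊕ {E // E ∈ H.edges})) := by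
    constructor
    · rw [Finset.disjoint_coe, Finset.disjoint_left]
      simp
    · rintro (x | E) (y | F) hadj
      · exact hadj.elim
      · simp
      · simp
      · exact hadj.elim
  have hdeg (E : {E // E ∈ H.edges}) :
      H.incidenceGraph.degree (Function.Embedding.inr E) = r := by
    have hnbr : H.incidenceGraph.neighborFinset (Function.Embedding.inr E) =
        E.1.map Function.Embedding.inl := by
      ext (x | F)
      · rw [SimpleGraph.mem_neighborFinset]
        exact (Finset.mem_map' Function.Embedding.inl).symm
      · rw [SimpleGraph.mem_neighborFinset]
        exact iff_of_false id (by simp)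
    rw [← SimpleGraph.card_neighborFinset_eq_degree, hnbr, Finset.card_map, hU E.1 E.2]
  have hcard := htree.card_edgeFinset
  rw [← SimpleGraph.isBipartiteWith_sum_degrees_eq_card_edges hbip, Finset.sum_map] at hcard
  simp only [hdeg, Finset.sum_const, Finset.card_univ, Fintype.card_coe, smul_eq_mul,
    Fintype.card_sum] at hcard
  exact hcard

/-! ### Recovering a hypertree from its cuts -/

/-- In a hypergraph without cycles, three vertices which are pairwise contained in hyperedges lie
in one hyperedge. -/
theorem IsAcyclic.mem_of_triangle (h : H.IsAcyclic) {u v w : S} {D E F : Finset S}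
    (huv : u ≠ v) (huw : u ≠ w) (hvw : v ≠ w) (hD : D ∈ H.edges) (hE : E ∈ H.edges)
    (hF : F ∈ H.edges) (huD : u ∈ D) (hvD : v ∈ D) (huE : u ∈ E) (hwE : w ∈ E)
    (hvF : v ∈ F) (hwF : w ∈ F) : w ∈ D := by
  have hp := isSimplePath_singleton hD huD hvD huv
  by_cases hEF : E = F
  · subst hEF
    have := h _ _ _ _ hp (isSimplePath_singleton hE huE hvF huv)
    simp only [List.cons.injEq, Prod.mk.injEq, and_true] at this
    exact this ▸ hwE
  · have hq : H.IsSimplePath u v [(E, w), (F, v)] :=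
      ⟨⟨hE, huE, hwE, hF, hwF, hvF, rfl⟩, by simp [huv, huw, hvw.symm], by simpa⟩
    simpa using h _ _ _ _ hp hq

variable [DecidableEq S]

theorem cutEdges_singleton {r : ℕ} (hr : 2 ≤ r) (hU : H.IsUniform r) (v : S) :
    H.cutEdges {v} = {E ∈ H.edges | v ∈ E} := by
  refine Finset.filter_congr fun E hE => ?_
  obtain ⟨i, hi, hiv⟩ := Finset.exists_mem_ne (by rw [hU E hE]; omega) v
  simp only [Finset.mem_singleton, exists_eq_right, and_iff_left_iff_imp]
  exact fun _ => ⟨i, hi, hiv⟩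

theorem sum_card_cutEdges_singleton [Fintype S] {r : ℕ} (hr : 2 ≤ r) (hU : H.IsUniform r) :
    ∑ v, (H.cutEdges {v}).card = H.edges.card * r := by
  simp only [cutEdges_singleton hr hU, Finset.card_filter]
  rw [Finset.sum_comm, ← smul_eq_mul, ← Finset.sum_const]
  refine Finset.sum_congr rfl fun E hE => ?_
  rw [← Finset.card_filter, Finset.filter_univ_mem, hU E hE]

/-- Inclusion-exclusion for the cut around two vertices. A hyperedge containing both of them is
separated, unless it has no other members. -/
theorem card_cutEdges_pair {r : ℕ} (hr : 2 ≤ r) (hU : H.IsUniform r) {u v : S} (huv : u ≠ v) :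
    (H.cutEdges {u, v}).card +
        (if r = 2 then 2 else 1) * {E ∈ H.edges | u ∈ E ∧ v ∈ E}.card =
      (H.cutEdges {u}).card + (H.cutEdges {v}).card := by
  rw [cutEdges_singleton hr hU, cutEdges_singleton hr hU, cutEdges]
  simp only [Finset.card_filter, Finset.mul_sum, ← Finset.sum_add_distrib]
  refine Finset.sum_congr rfl fun E hE => ?_
  have hcut : ((∃ i ∈ E, i ∈ ({u, v} : Finset S)) ∧ ∃ i ∈ E, i ∉ ({u, v} : Finset S)) ↔
      (u ∈ E ∨ v ∈ E) ∧ ¬ (u ∈ E ∧ v ∈ E ∧ r = 2) := by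
    have hin : (∃ i ∈ E, i ∈ ({u, v} : Finset S)) ↔ u ∈ E ∨ v ∈ E := by
      simp [and_or_left, exists_or]
    rw [hin]
    refine and_congr_right fun huvE => ?_
    have hcard : (E \ {u, v}).card + (E ∩ {u, v}).card = r := by
      rw [Finset.card_sdiff_add_card_inter, hU E hE]
    have hout : (∃ i ∈ E, i ∉ ({u, v} : Finset S)) ↔ (E \ {u, v}).card ≠ 0 := by
      rw [Finset.card_ne_zero]
      simp only [Finset.Nonempty, Finset.mem_sdiff]
    have hinter : (E ∩ {u, v}).card = (if u ∈ E then 1 else 0) + if v ∈ E then 1 else 0 := by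
      rw [Finset.inter_comm, ← Finset.filter_mem_eq_inter, Finset.card_filter,
        Finset.sum_pair huv]
    rw [hout]
    by_cases huE : u ∈ E <;> by_cases hvE : v ∈ E <;>
      simp only [huE, hvE, if_true, if_false, or_self, true_and, false_and, and_false,
        not_false_eq_true, iff_true] at huvE hinter ⊢ <;> omega
  simp only [hcut]
  by_cases huE : u ∈ E <;> by_cases hvE : v ∈ E <;> by_cases hr2 : r = 2 <;>
    simp [huE, hvE, hr2]

/-- If every cut separates at least as many hyperedges of `H₁` as of `H₂`, equality holds for the
cuts around one vertex because the degrees have the same sum. The cuts around two vertices then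
show that vertices with a common hyperedge in `H₁` have one in `H₂`, so that each hyperedge of `H₁`
lies in a hyperedge of `H₂`. -/
theorem eq_of_card_cutEdges_le [Fintype S] {r : ℕ} (hr : 2 ≤ r) {H₁ H₂ : EntangledHypergraph S}
    (hT₁ : H₁.IsHypertree) (hU₁ : H₁.IsUniform r) (hT₂ : H₂.IsHypertree) (hU₂ : H₂.IsUniform r)
    (hle : ∀ A, (H₂.cutEdges A).card ≤ (H₁.cutEdges A).card) : H₁ = H₂ := by
  have hcard : H₁.edges.card = H₂.edges.card := by
    rcases isEmpty_or_nonempty S with hS | hS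
    · have hempty (H : EntangledHypergraph S) (hU : H.IsUniform r) : H.edges = ∅ := by
        refine Finset.eq_empty_of_forall_notMem fun E hE => ?_
        have := hU E hE
        rw [Finset.eq_empty_of_isEmpty E, Finset.card_empty] at this
        omega
      rw [hempty H₁ hU₁, hempty H₂ hU₂]
    · have h₁ := hT₁.card_eq hU₁ (by omega)
      have h₂ := hT₂.card_eq hU₂ (by omega)
      obtain ⟨k, rfl⟩ : ∃ k, r = k + 2 := ⟨r - 2, by omega⟩
      refine Nat.eq_of_mul_eq_mul_right (Nat.succ_pos k) ?_
      rw [Nat.succ_eq_add_one]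
      linarith
  have hdeg (v : S) : (H₂.cutEdges {v}).card = (H₁.cutEdges {v}).card := by
    refine (Finset.sum_eq_sum_iff_of_le fun v _ => hle {v}).1 ?_ v (Finset.mem_univ v)
    rw [sum_card_cutEdges_singleton hr hU₁, sum_card_cutEdges_singleton hr hU₂, hcard]
  have hcodeg {u v : S} (huv : u ≠ v) {E : Finset S} (hE : E ∈ H₁.edges) (hu : u ∈ E)
      (hv : v ∈ E) : ∃ D ∈ H₂.edges, u ∈ D ∧ v ∈ D := by
    have h₁ := card_cutEdges_pair hr hU₁ huv
    have h₂ := card_cutEdges_pair hr hU₂ huv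
    have hlt : 0 < {E ∈ H₁.edges | u ∈ E ∧ v ∈ E}.card :=
      Finset.card_pos.2 ⟨E, Finset.mem_filter.2 ⟨hE, hu, hv⟩⟩
    have huv := hle {u, v}
    have : 0 < {E ∈ H₂.edges | u ∈ E ∧ v ∈ E}.card := by
      rw [hdeg, hdeg] at h₂
      split_ifs at h₁ h₂ <;> omega
    obtain ⟨D, hD⟩ := Finset.card_pos.1 this
    exact ⟨D, Finset.mem_filter.1 hD⟩
  have hsub : H₁.edges ⊆ H₂.edges := by
    intro E hE
    have hEr := hU₁ E hE
    obtain ⟨u, hu, v, hv, huv⟩ := Finset.one_lt_card.1 (by omega : 1 < E.card)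
    obtain ⟨D, hD, huD, hvD⟩ := hcodeg huv hE hu hv
    have hED : E ⊆ D := by
      intro w hw
      by_cases huw : u = w
      · exact huw ▸ huD
      by_cases hvw : v = w
      · exact hvw ▸ hvD
      obtain ⟨F, hF, huF, hwF⟩ := hcodeg huw hE hu hw
      obtain ⟨G, hG, hvG, hwG⟩ := hcodeg hvw hE hv hw
      exact hT₂.2.mem_of_triangle huv huw hvw hD hF hG huD hvD huF hwF hvG hwG
    rwa [Finset.eq_of_subset_of_card_le hED (by rw [hEr, hU₂ D hD])]
  exact EntangledHypergraph.ext (Finset.eq_of_subset_of_card_le hsub hcard.ge)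

end Hypertree

end EntangledHypergraph

theorem mainTheorem1 {S : Type u} [Fintype S] [DecidableEq S] (r : ℕ) (hr : 2 ≤ r)
    (H₁ H₂ : EntangledHypergraph S)
    (hT₁ : H₁.IsHypertree) (hU₁ : H₁.IsUniform r)
    (hT₂ : H₂.IsHypertree) (hU₂ : H₂.IsUniform r)
    (hne : H₁ ≠ H₂) :
    LOCCIncomparable H₁.state H₂.state :=
  ⟨fun h => hne (EntangledHypergraph.eq_of_card_cutEdges_le hr hT₁ hU₁ hT₂ hU₂
      (EntangledHypergraph.card_cutEdges_le_of_LOCCConvertible h)),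
    fun h => hne.symm (EntangledHypergraph.eq_of_card_cutEdges_le hr hT₂ hU₂ hT₁ hU₁
      (EntangledHypergraph.card_cutEdges_le_of_LOCCConvertible h))⟩
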